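/- Let $\mathbb T$ be the unit circle with normalized arc length measure. For $a\in L^\infty(\mathbb T)$ with Fourier coefficients $a_j=\frac1{2\pi}\int_0^{2\pi}a(e^{it})e^{-ijt}\,dt$, let $L(a)$ be the Laurent operator on $l^2(\mathbb Z)$ with matrix $(a_{i-j})_{i,j\in\mathbb Z}$, let $T(a)$ be the Toeplitz operator on $l^2(\mathbb Z^+)$, $\mathbb Z^+=\{0,1,2,\dots\}$, with matrix $(a_{i-j})_{i,j\ge 0}$, and let $\tilde a(t)=a(1/t)$. Let $\mathcal A=\mathcal A_{L^\infty(\mathbb T),\mathbb C}(\mathbb Z^+)$ be the smallest closed $C^*$-subalgebra of $L(l^2(\mathbb Z^+))$ which contains all operators $T(a)$, $a\in L^\infty(\mathbb T)$. Let $(U_kx)_n=x_{n-k}$ on $l^2(\mathbb Z)$. Let $P_n$ be the orthogonal projection onto the span of the first $n$ standard basis vectors of $l^2(\mathbb Z^+)$. The finite sections of an operator $A$ on $l^2(\mathbb Z^+)$ are the $n\times n$ matrices $P_nAP_n$; they are called stable if they are invertible for all sufficiently large $n$, with uniformly bounded norms of the inverses. For an invertible operator $B$ on $l^2(\mathbb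 Z^+)$, $P_1B^{-1}P_1$ denotes the number in the $00$th entry of $B^{-1}$. (1) For each $A\in\mathcal A$ there is exactly one $s_A\in L^\infty(\mathbb T)$, called the symbol of $A$, such that $U_{-n}AU_n\to L(s_A)$ and $(U_{-n}AU_n)^*\to L(s_A)^*$ strongly on $l^2(\mathbb Z)$ as $n\to\infty$, where $A$ is extended by zero to $l^2(\mathbb Z)$. (2) Let $A\in\mathcal A$ and suppose that the finite sections of $A$ are stable. Then $T(\widetilde{s_A})$ is invertible, $P_1T(\widetilde{s_A})^{-1}P_1\neq0$, and \[ \lim_{n\to\infty}\frac{\det(P_nAP_n)}{\det(P_{n-1}AP_{n-1})}=\frac{1}{P_1\,T(\widetilde{s_A})^{-1}P_1}. \] (3) For every $a\in L^\infty(\mathbb T)$, the operator $T(a)$ belongs to $\mathcal A$ and has the symbol $a$. If the finite sections of $T(a)$ are stable, then $T(a)$ is invertible, $P_1T(a)^{-1}P_1\ne0$, and (first Szegő limit theorem) \[ \lim_{n\to\infty}\frac{\det(P_nT(a)P_n)}{\det(P_{n-1}T(a)P_{n-1})}=\frac{1}{P_1\,T(a)^{-1}P_1}. \] -/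

import Mathlib

open Filter Topology MeasureTheory
open scoped ENNReal

noncomputable section

namespace SzegoToeplitz

instance factTwoPiPos : Fact (0 < 2 * Real.pi) := ⟨Real.two_pi_pos⟩

/-- The complex unit circle, parametrized by the angle `t ∈ ℝ / 2πℤ` (the point is `e^{it}`). -/
abbrev Torus : Type := AddCircle (2 * Real.pi)

/-- The normalized arc length measure `dt / 2π` on the circle. -/
abbrev arc : Measure Torus := AddCircle.haarAddCircle

/-- `L^∞` of the circle (functions modulo equality almost everywhere). -/
abbrev LInfty : Type := Lp ℂ ∞ arc

/-- The Hilbert space `l²(I)`. -/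
abbrev ell2 (I : Type) : Type := lp (fun _ : I => ℂ) 2

/-- The standard basis vectors of `l²(I)`. -/
def basisVec {I : Type} [DecidableEq I] (i : I) : ell2 I := lp.single 2 i 1

/-- The matrix entry of an operator with respect to the standard basis. -/
def entry {I : Type} [DecidableEq I] (A : ell2 I →L[ℂ] ell2 I) (i j : I) : ℂ := A (basisVec j) i

/-! ### Relabelling coordinates -/

theorem summable_extend {I J : Type} {f : I → J} (hf : Function.Injective f) (x : ell2 I) :
    Summable fun j => ‖Function.extend f (x : I → ℂ) 0 j‖ ^ (2 : ℝ≥0∞).toReal := by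
  have hx : Summable fun i => ‖x i‖ ^ (2 : ℝ≥0∞).toReal :=
    (memℓp_gen_iff (by norm_num)).1 (lp.memℓp x)
  rw [← hf.summable_iff]
  · simpa [Function.comp_def, hf.extend_apply] using hx
  · intro j hj
    rw [Function.extend_apply' _ _ _ (by simpa using hj)]
    simp

/-- For an injective map `f : I → J`, the isometry `l²(I) → l²(J)` which places the entry `x i`
at the position `f i` and `0` at all positions outside the range of `f`. -/
def place {I J : Type} (f : I → J) (hf : Function.Injective f) : ell2 I →ₗᵢ[ℂ] ell2 J where
  toFun x := ⟨Function.extend f (x : I → ℂ) 0, memℓp_gen (summable_extend hf x)⟩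
  map_add' x y := by
    ext j
    by_cases hj : ∃ i, f i = j
    · obtain ⟨i, rfl⟩ := hj
      change Function.extend f (x + y : I → ℂ) 0 (f i) =
        Function.extend f (x : I → ℂ) 0 (f i) + Function.extend f (y : I → ℂ) 0 (f i)
      simp only [hf.extend_apply, Pi.add_apply]
    · change Function.extend f (x + y : I → ℂ) 0 j =
        Function.extend f (x : I → ℂ) 0 j + Function.extend f (y : I → ℂ) 0 j
      simp [Function.extend_apply' _ _ _ hj]
  map_smul' c x := by
    ext j
    by_cases hj : ∃ i, f i = j
    · obtain ⟨i, rfl⟩ := hj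
      simp [hf.extend_apply]
    · simp [Function.extend_apply' _ _ _ hj]
  norm_map' x := by
    rw [lp.norm_eq_tsum_rpow (by norm_num), lp.norm_eq_tsum_rpow (by norm_num)]
    congr 1
    change ∑' j, ‖Function.extend f (x : I → ℂ) 0 j‖ ^ (2 : ℝ≥0∞).toReal = _
    rw [← hf.tsum_eq]
    · simp [hf.extend_apply]
    · intro j hj
      by_contra h
      apply hj
      change ‖Function.extend f (x : I → ℂ) 0 j‖ ^ (2 : ℝ≥0∞).toReal = 0
      rw [Function.extend_apply' _ _ _ (by simpa using h)]
      simp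

theorem place_apply {I J : Type} {f : I → J} (hf : Function.Injective f) (x : ell2 I) (i : I) :
    place f hf x (f i) = x i :=
  hf.extend_apply _ _ _

/-- The natural inclusion of `l²(ℤ⁺)` into `l²(ℤ)`. -/
def incl : ell2 ℕ →L[ℂ] ell2 ℤ :=
  (place (fun n : ℕ => (n : ℤ)) Nat.cast_injective).toContinuousLinearMap

/-- The orthogonal projection of `l²(ℤ)` onto `l²(ℤ⁺)`, as a map onto `l²(ℤ⁺)`; it is the adjoint
of the inclusion. -/
def proj : ell2 ℤ →L[ℂ] ell2 ℕ := ContinuousLinearMap.adjoint incl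

/-- The shift operator `U_k` on `l²(ℤ)`, `(U_k x)_n = x_{n-k}`. -/
def shift (k : ℤ) : ell2 ℤ →L[ℂ] ell2 ℤ :=
  (place (fun n : ℤ => n + k) (add_left_injective k)).toContinuousLinearMap

theorem shift_apply (k : ℤ) (x : ell2 ℤ) (n : ℤ) : shift k x n = x (n - k) := by
  have h := place_apply (add_left_injective k) x (n - k)
  simpa [shift] using h

theorem inner_basisVec {I : Type} [DecidableEq I] (i : I) (x : ell2 I) :
    inner ℂ (basisVec i) x = x i := by
  simp [basisVec, lp.inner_single_left]

theorem incl_basisVec (n : ℕ) : incl (basisVec n) = basisVec (n : ℤ) := by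
  ext j
  by_cases hj : ∃ i : ℕ, (i : ℤ) = j
  · obtain ⟨i, rfl⟩ := hj
    have h := place_apply (f := fun n : ℕ => (n : ℤ)) Nat.cast_injective (basisVec n) i
    refine h.trans ?_
    by_cases hin : i = n
    · simp [basisVec, hin]
    · simp [basisVec, hin]
  · refine (Function.extend_apply' _ _ _ hj).trans ?_
    have hne : j ≠ (n : ℤ) := fun h => hj ⟨n, h.symm⟩
    simp [basisVec, hne]

theorem proj_apply (x : ell2 ℤ) (n : ℕ) : proj x n = x n := by
  rw [← inner_basisVec n, proj, ContinuousLinearMap.adjoint_inner_right, incl_basisVec,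
    inner_basisVec]

/-! ### Laurent and Toeplitz operators -/

/-- The bounded operator of multiplication by `a ∈ L^∞` on `L²` of the circle. -/
def mulOp (a : LInfty) : Lp ℂ 2 arc →L[ℂ] Lp ℂ 2 arc :=
  (ContinuousLinearMap.mul ℂ ℂ).holderL arc ∞ 2 2 a

/-- The Laurent operator `L(a)` on `l²(ℤ)`: multiplication by `a`, transported by the Fourier
transform. Its matrix is `(a_{i-j})`, see `entry_laurent`. -/
def laurent (a : LInfty) : ell2 ℤ →L[ℂ] ell2 ℤ :=
  (fourierBasis (T := 2 * Real.pi)).repr.toLinearIsometry.toContinuousLinearMap ∘L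
    mulOp a ∘L (fourierBasis (T := 2 * Real.pi)).repr.symm.toLinearIsometry.toContinuousLinearMap

theorem entry_laurent (a : LInfty) (i j : ℤ) :
    entry (laurent a) i j = fourierCoeff (a : Torus → ℂ) (i - j) := by
  have h1 : entry (laurent a) i j =
      (fourierBasis (T := 2 * Real.pi)).repr (mulOp a (fourierLp 2 j)) i := by
    have h0 : (fourierBasis (T := 2 * Real.pi)).repr.symm (basisVec j) =
        fourierLp (T := 2 * Real.pi) 2 j := by
      rw [← coe_fourierBasis, ← HilbertBasis.repr_symm_single]
      rfl
    rw [← h0]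
    rfl
  rw [h1, fourierBasis_repr]
  unfold fourierCoeff
  apply integral_congr_ae
  have h2 : (mulOp a (fourierLp 2 j) : Torus → ℂ) =ᵐ[arc]
      fun x => a x * (fourierLp (T := 2 * Real.pi) 2 j : Torus → ℂ) x :=
    (ContinuousLinearMap.mul ℂ ℂ).coeFn_holder a (fourierLp (T := 2 * Real.pi) 2 j)
  filter_upwards [h2, coeFn_fourierLp (T := 2 * Real.pi) 2 j] with x hx hx2
  rw [hx, hx2, show -(i - j) = -i + j by ring, fourier_add]
  simp only [smul_eq_mul]
  ring

/-- The Toeplitz operator `T(a) = P L(a) P` on `l²(ℤ⁺)`. -/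
def toeplitz (a : LInfty) : ell2 ℕ →L[ℂ] ell2 ℕ := proj ∘L laurent a ∘L incl

theorem entry_toeplitz (a : LInfty) (i j : ℕ) :
    entry (toeplitz a) i j = fourierCoeff (a : Torus → ℂ) ((i : ℤ) - j) := by
  rw [← entry_laurent]
  simp [entry, toeplitz, proj_apply, incl_basisVec]

/-- The Toeplitz algebra: the smallest closed (unital) `*`-subalgebra of `L(l²(ℤ⁺))` which contains
all Toeplitz operators `T(a)` with `a ∈ L^∞` (and all multiples of the identity, which are the
multiplication operators with constant coefficients). -/
def toeplitzAlgebra : StarSubalgebra ℂ (ell2 ℕ →L[ℂ] ell2 ℕ) :=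
  (StarAlgebra.adjoin ℂ (Set.range toeplitz)).topologicalClosure

/-- The function `ã(t) = a(1/t)`; in the angular variable, `t ↦ -t`. -/
def reflect (a : LInfty) : LInfty :=
  Lp.compMeasurePreserving (fun t : Torus => -t) (Measure.measurePreserving_neg arc) a

theorem reflect_ae (a : LInfty) : (reflect a : Torus → ℂ) =ᵐ[arc] fun t => a (-t) :=
  Lp.coeFn_compMeasurePreserving a (Measure.measurePreserving_neg arc)

/-! ### Symbols, finite sections and stability -/

/-- `s` is the symbol of `A`: with `A` extended by zero to `l²(ℤ)`, the operators `U_{-n} A U_n`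
converge `*`-strongly to the Laurent operator `L(s)` as `n → ∞`. -/
def IsSymbol (A : ell2 ℕ →L[ℂ] ell2 ℕ) (s : LInfty) : Prop :=
  (∀ x : ell2 ℤ, Tendsto
    (fun n : ℕ => (shift (-(n : ℤ)) ∘L (incl ∘L A ∘L proj) ∘L shift (n : ℤ)) x)
    atTop (𝓝 (laurent s x))) ∧
  (∀ x : ell2 ℤ, Tendsto
    (fun n : ℕ =>
      ContinuousLinearMap.adjoint (shift (-(n : ℤ)) ∘L (incl ∘L A ∘L proj) ∘L shift (n : ℤ)) x)
    atTop (𝓝 (ContinuousLinearMap.adjoint (laurent s) x)))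

/-- The `n`th finite section `P_n A P_n`, as an `n × n` matrix. -/
def finSec (A : ell2 ℕ →L[ℂ] ell2 ℕ) (n : ℕ) : Matrix (Fin n) (Fin n) ℂ :=
  Matrix.of fun i j => entry A i j

/-- The finite sections of `A` are stable: for all sufficiently large `n` the section is invertible,
and the operator norms (with respect to the Euclidean norm) of the inverses are uniformly
bounded. -/
def StableSections (A : ell2 ℕ →L[ℂ] ell2 ℕ) : Prop :=
  ∃ (N : ℕ) (C : ℝ), ∀ n : ℕ, N ≤ n →
    IsUnit (finSec A n) ∧ ‖Matrix.toEuclideanCLM (𝕜 := ℂ) (finSec A n)⁻¹‖ ≤ C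

/-- `P_1 A⁻¹ P_1`, the `00`th entry of the inverse of `A` (for invertible `A`). -/
def invEntry (A : ell2 ℕ →L[ℂ] ell2 ℕ) : ℂ := entry (Ring.inverse A) 0 0

end SzegoToeplitz

end

open Filter Topology MeasureTheory
open scoped ENNReal

noncomputable section

namespace SzegoToeplitz

/-! ### Operators on `l²` and their matrices -/

section Ell2

variable {I : Type} [DecidableEq I]

/-! If `M n` arises from `M (n + 1)` by deleting the first row and column, Cramer's rule identifies
`det (M n) / det (M (n + 1))` with the 00 entry of `(M (n + 1))⁻¹`. For a stable sequence converging
*-strongly to `B`, the limit `B` is invertible and these entries tend to that of `B⁻¹`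
(`isUnit_of_tendsto_matOp`, `tendsto_inv_zero_zero`). If `B` is a Toeplitz operator, the limit entry
is nonzero, so the quotients may be inverted (`tendsto_det_div_det`).

Finite sections of `A` lose their last row and column instead, so the order of the indices is
reversed; determinants and stability do not change. The reversed section is the compression to `ℤ⁺`
of `J U_{-n} A U_n J`, where `J` is `flip` (`matOp_revSec`). It therefore tends to the compression
of `J L(s) J = L(s̃)`, which is `T(s̃)`.

Symbols exist because *-strong limits of `U_{-n} A U_n` respect the algebra operations and norm
limits, and because `‖L(a)‖ = ‖a‖` makes the symbols of a convergent sequence converge. The same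
isometry gives uniqueness. -/

theorem hasSum_smul_basisVec (x : ell2 I) : HasSum (fun i => x i • basisVec i) x := by
  have h := lp.hasSum_single (p := 2) (by norm_num) x
  have h1 : (fun i => lp.single 2 i (x i)) = fun i => x i • (basisVec i : ell2 I) := by
    funext i
    rw [basisVec, ← lp.single_smul, smul_eq_mul, mul_one]
  rwa [h1] at h

theorem ext_basisVec {E : Type*} [NormedAddCommGroup E] [NormedSpace ℂ E]
    {A B : ell2 I →L[ℂ] E} (h : ∀ j, A (basisVec j) = B (basisVec j)) : A = B := by
  ext1 x
  have hA := (hasSum_smul_basisVec x).mapL A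
  have hB := (hasSum_smul_basisVec x).mapL B
  simp only [map_smul, h] at hA hB
  exact hA.unique hB

theorem ext_entry {A B : ell2 I →L[ℂ] ell2 I} (h : ∀ i j, entry A i j = entry B i j) : A = B :=
  ext_basisVec fun j => by ext i; exact h i j

theorem entry_adjoint (A : ell2 I →L[ℂ] ell2 I) (i j : I) :
    entry (ContinuousLinearMap.adjoint A) i j = star (entry A j i) := by
  simp only [entry]
  rw [← inner_basisVec, ContinuousLinearMap.adjoint_inner_right, ← inner_basisVec]
  exact (inner_conj_symm _ _).symm

theorem basisVec_apply (i j : I) : (basisVec j : ell2 I) i = if i = j then 1 else 0 := by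
  simp [basisVec, Pi.single_apply]

end Ell2

theorem place_basisVec {I J : Type} [DecidableEq I] [DecidableEq J] {f : I → J}
    (hf : Function.Injective f) (i : I) : place f hf (basisVec i) = basisVec (f i) := by
  ext j
  by_cases hj : ∃ k, f k = j
  · obtain ⟨k, rfl⟩ := hj
    rw [place_apply, basisVec_apply, basisVec_apply]
    simp [hf.eq_iff]
  · refine (Function.extend_apply' _ _ _ hj).trans ?_
    rw [basisVec_apply, if_neg fun h => hj ⟨i, h.symm⟩]
    rfl

/-! ### Finite sections as operators -/

/-- The isometric embedding of `ℂⁿ` as the span of the first `n` basis vectors of `l²(ℤ⁺)`. -/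
def emb (n : ℕ) : EuclideanSpace ℂ (Fin n) →ₗᵢ[ℂ] ell2 ℕ :=
  (place (fun i : Fin n => (i : ℕ)) Fin.val_injective).comp
    (lpPiLpₗᵢ (fun _ : Fin n => ℂ) ℂ).symm.toLinearIsometry

theorem emb_apply_fin {n : ℕ} (x : EuclideanSpace ℂ (Fin n)) (i : Fin n) : emb n x i = x i :=
  place_apply (f := fun i : Fin n => (i : ℕ)) Fin.val_injective _ i

theorem emb_apply_of_le {n : ℕ} (x : EuclideanSpace ℂ (Fin n)) {i : ℕ} (h : n ≤ i) :
    emb n x i = 0 :=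
  Function.extend_apply' _ _ _ (by rintro ⟨j, hj⟩; have := j.2; omega)

/-- The coordinate projection of `l²(ℤ⁺)` onto `ℂⁿ`. -/
def cut (n : ℕ) : ell2 ℕ →L[ℂ] EuclideanSpace ℂ (Fin n) :=
  ContinuousLinearMap.adjoint (emb n).toContinuousLinearMap

theorem emb_single {n : ℕ} (i : Fin n) : emb n (EuclideanSpace.single i 1) = basisVec (i : ℕ) := by
  ext j
  rw [basisVec_apply]
  by_cases hj : j < n
  · rw [show j = ((⟨j, hj⟩ : Fin n) : ℕ) from rfl, emb_apply_fin]
    simp [Fin.ext_iff]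
  · rw [emb_apply_of_le _ (not_lt.1 hj), if_neg (by omega)]

theorem cut_apply (n : ℕ) (x : ell2 ℕ) (i : Fin n) : cut n x i = x i := by
  have h : inner ℂ (EuclideanSpace.single i (1 : ℂ)) (cut n x) = cut n x i := by
    simp [EuclideanSpace.inner_single_left]
  rw [← h, cut, ContinuousLinearMap.adjoint_inner_right]
  simp [emb_single, inner_basisVec]

theorem norm_cut_apply_le (n : ℕ) (x : ell2 ℕ) : ‖cut n x‖ ≤ ‖x‖ := by
  have h : ‖cut n‖ ≤ 1 := by
    rw [cut, LinearIsometryEquiv.norm_map]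
    exact (emb n).norm_toContinuousLinearMap_le
  simpa using ContinuousLinearMap.le_of_opNorm_le _ h x

theorem cut_emb {n : ℕ} (x : EuclideanSpace ℂ (Fin n)) : cut n (emb n x) = x := by
  ext i
  rw [cut_apply, emb_apply_fin]

theorem tendsto_emb_cut (x : ell2 ℕ) : Tendsto (fun n => emb n (cut n x)) atTop (𝓝 x) := by
  refine (hasSum_smul_basisVec x).tendsto_sum_nat.congr fun n => ?_
  ext j
  rw [lp.coeFn_sum, Finset.sum_apply]
  simp only [lp.coeFn_smul, Pi.smul_apply, basisVec_apply, smul_eq_mul, mul_ite, mul_one,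
    mul_zero, Finset.sum_ite_eq, Finset.mem_range]
  by_cases hj : j < n
  · rw [if_pos hj]
    exact ((emb_apply_fin (cut n x) ⟨j, hj⟩).trans (cut_apply n x ⟨j, hj⟩)).symm
  · rw [if_neg hj, emb_apply_of_le _ (not_lt.1 hj)]

/-- The operator on `l²(ℤ⁺)` acting as the `n × n` matrix `M` on the first `n` coordinates, and as
zero on the remaining ones. -/
def matOp {n : ℕ} (M : Matrix (Fin n) (Fin n) ℂ) : ell2 ℕ →L[ℂ] ell2 ℕ :=
  (emb n).toContinuousLinearMap ∘L Matrix.toEuclideanCLM (𝕜 := ℂ) M ∘L cut n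

theorem matOp_apply {n : ℕ} (M : Matrix (Fin n) (Fin n) ℂ) (x : ell2 ℕ) :
    matOp M x = emb n (Matrix.toEuclideanCLM (𝕜 := ℂ) M (cut n x)) := rfl

theorem adjoint_matOp {n : ℕ} (M : Matrix (Fin n) (Fin n) ℂ) :
    ContinuousLinearMap.adjoint (matOp M) = matOp M.conjTranspose := by
  have h : Matrix.toEuclideanCLM (𝕜 := ℂ) M.conjTranspose =
      ContinuousLinearMap.adjoint (Matrix.toEuclideanCLM (𝕜 := ℂ) M) :=
    map_star (Matrix.toEuclideanCLM (𝕜 := ℂ)) M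
  simp only [matOp, ContinuousLinearMap.adjoint_comp, h, cut,
    ContinuousLinearMap.adjoint_adjoint, ContinuousLinearMap.comp_assoc]

theorem norm_matOp_inv_le {n : ℕ} {M : Matrix (Fin n) (Fin n) ℂ} {C : ℝ}
    (h : ‖Matrix.toEuclideanCLM (𝕜 := ℂ) M⁻¹‖ ≤ C) : ‖matOp M⁻¹‖ ≤ C := by
  refine ContinuousLinearMap.opNorm_le_bound _ ((norm_nonneg _).trans h) fun x => ?_
  rw [matOp_apply, LinearIsometry.norm_map]
  refine (ContinuousLinearMap.le_of_opNorm_le _ h _).trans ?_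
  gcongr
  · exact (norm_nonneg _).trans h
  · exact norm_cut_apply_le n x

theorem matOp_mul {n : ℕ} (M N : Matrix (Fin n) (Fin n) ℂ) (x : ell2 ℕ) :
    matOp (M * N) x = matOp M (matOp N x) := by
  simp only [matOp_apply, cut_emb, map_mul]
  rfl

theorem matOp_one (n : ℕ) (x : ell2 ℕ) :
    matOp (1 : Matrix (Fin n) (Fin n) ℂ) x = emb n (cut n x) := by
  simp [matOp_apply]

theorem entry_matOp_fin {n : ℕ} (M : Matrix (Fin n) (Fin n) ℂ) (i j : Fin n) :
    entry (matOp M) i j = M i j := by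
  simp only [entry, matOp_apply, emb_apply_fin, ← emb_single, cut_emb]
  simp

theorem entry_matOp_of_le_left {n : ℕ} (M : Matrix (Fin n) (Fin n) ℂ) {i : ℕ} (j : ℕ) (h : n ≤ i) :
    entry (matOp M) i j = 0 :=
  emb_apply_of_le _ h

theorem cut_basisVec_of_le {n j : ℕ} (h : n ≤ j) : cut n (basisVec j) = 0 := by
  ext i
  rw [cut_apply, basisVec_apply, if_neg (by omega)]
  rfl

theorem entry_matOp_of_le_right {n : ℕ} (M : Matrix (Fin n) (Fin n) ℂ) (i : ℕ) {j : ℕ}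
    (h : n ≤ j) : entry (matOp M) i j = 0 := by
  rw [entry, matOp_apply, cut_basisVec_of_le h, map_zero, map_zero]
  rfl

/-- Pass to the limit in `‖P_n x‖ = ‖M_n⁻¹ M_n x‖ ≤ C ‖M_n x‖`. -/
theorem norm_le_of_tendsto_matOp {M : ∀ n, Matrix (Fin n) (Fin n) ℂ} {B : ell2 ℕ →L[ℂ] ell2 ℕ}
    (hB : ∀ x, Tendsto (fun n => matOp (M n) x) atTop (𝓝 (B x))) {C : ℝ}
    (hM : ∀ᶠ n in atTop, IsUnit (M n) ∧ ‖matOp (M n)⁻¹‖ ≤ C) (x : ell2 ℕ) :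
    ‖x‖ ≤ C * ‖B x‖ := by
  refine le_of_tendsto_of_tendsto (tendsto_emb_cut x).norm ((hB x).norm.const_mul C) ?_
  filter_upwards [hM] with n hn
  rw [← matOp_one, ← Matrix.nonsing_inv_mul _ ((Matrix.isUnit_iff_isUnit_det _).1 hn.1), matOp_mul]
  exact ContinuousLinearMap.le_of_opNorm_le _ hn.2 _

/-- If a stable sequence of matrices converges `*`-strongly, then its limit is invertible. -/
theorem isUnit_of_tendsto_matOp {M : ∀ n, Matrix (Fin n) (Fin n) ℂ} {B : ell2 ℕ →L[ℂ] ell2 ℕ}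
    (hB : ∀ x, Tendsto (fun n => matOp (M n) x) atTop (𝓝 (B x)))
    (hB' : ∀ x, Tendsto (fun n => ContinuousLinearMap.adjoint (matOp (M n)) x) atTop
      (𝓝 (ContinuousLinearMap.adjoint B x))) {C : ℝ}
    (hM : ∀ᶠ n in atTop, IsUnit (M n) ∧ ‖matOp (M n)⁻¹‖ ≤ C) : IsUnit B := by
  have h1 := norm_le_of_tendsto_matOp hB hM
  have h2 : ∀ x, ‖x‖ ≤ C * ‖ContinuousLinearMap.adjoint B x‖ := by
    refine norm_le_of_tendsto_matOp (M := fun n => (M n).conjTranspose)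
      (by simpa only [adjoint_matOp] using hB') ?_
    filter_upwards [hM] with n hn
    refine ⟨hn.1.star, ?_⟩
    rw [← Matrix.conjTranspose_nonsing_inv, ← adjoint_matOp, LinearIsometryEquiv.norm_map]
    exact hn.2
  rw [ContinuousLinearMap.isUnit_iff_bijective,
    ContinuousLinearMap.bijective_iff_dense_range_and_antilipschitz]
  refine ⟨?_, C.toNNReal, ?_⟩
  -- The range is dense because its orthogonal complement is the kernel of the adjoint, which is
  -- trivial by `h2`.
  · rw [Submodule.topologicalClosure_eq_top_iff, ContinuousLinearMap.orthogonal_range, eq_bot_iff]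
    intro x hx
    have hx0 : ContinuousLinearMap.adjoint B x = 0 := hx
    simpa [hx0] using h2 x
  · refine AddMonoidHomClass.antilipschitz_of_bound _ fun x => (h1 x).trans ?_
    gcongr
    exact Real.le_coe_toNNReal C

/-- The `00` entries of the inverses of a stable, `*`-strongly convergent sequence of matrices
converge to the `00` entry of the inverse of the limit. -/
theorem tendsto_inv_zero_zero {M : ∀ n, Matrix (Fin n) (Fin n) ℂ} {B : ell2 ℕ →L[ℂ] ell2 ℕ}
    (hB : ∀ x, Tendsto (fun n => matOp (M n) x) atTop (𝓝 (B x))) {C : ℝ}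
    (hM : ∀ᶠ n in atTop, IsUnit (M n) ∧ ‖matOp (M n)⁻¹‖ ≤ C) (hu : IsUnit B) :
    Tendsto (fun n => (M (n + 1))⁻¹ 0 0) atTop (𝓝 (invEntry B)) := by
  set x : ell2 ℕ := Ring.inverse B (basisVec 0) with hx
  have hBx : B x = basisVec 0 := by
    change (B * Ring.inverse B) (basisVec 0) = basisVec 0
    rw [Ring.mul_inverse_cancel _ hu]
    rfl
  have h1 : Tendsto (fun n => C * ‖basisVec 0 - matOp (M n) x‖) atTop (𝓝 0) := by
    have h := ((hB x).const_sub (basisVec 0)).norm.const_mul C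
    simpa [hBx] using h
  -- Here `M_n⁻¹ e_0 - P_n x = M_n⁻¹ (e_0 - M_n x)`, and stability bounds the first factor.
  have h2 : Tendsto (fun n => matOp (M n)⁻¹ (basisVec 0) - emb n (cut n x)) atTop (𝓝 0) := by
    refine squeeze_zero_norm' ?_ h1
    filter_upwards [hM] with n hn
    rw [← matOp_one, ← Matrix.nonsing_inv_mul _ ((Matrix.isUnit_iff_isUnit_det _).1 hn.1),
      matOp_mul, ← map_sub]
    exact ContinuousLinearMap.le_of_opNorm_le _ hn.2 _
  have h3 : Tendsto (fun n => matOp (M n)⁻¹ (basisVec 0)) atTop (𝓝 x) := by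
    simpa using h2.add (tendsto_emb_cut x)
  have h4 := ((innerSL ℂ (basisVec (0 : ℕ))).continuous.tendsto x).comp
    (h3.comp (tendsto_add_atTop_nat 1))
  simp only [Function.comp_def, innerSL_apply_apply, inner_basisVec] at h4
  refine h4.congr fun n => ?_
  exact entry_matOp_fin (M (n + 1))⁻¹ 0 0

/-! ### Laurent operators -/

/-- The pointwise product in `L^∞`. -/
def mulLInfty (a b : LInfty) : LInfty := (ContinuousLinearMap.mul ℂ ℂ).holder ∞ a b

theorem mulLInfty_ae (a b : LInfty) : (mulLInfty a b : Torus → ℂ) =ᵐ[arc] fun t => a t * b t :=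
  (ContinuousLinearMap.mul ℂ ℂ).coeFn_holder a b

theorem mulOp_ae (a : LInfty) (f : Lp ℂ 2 arc) :
    (mulOp a f : Torus → ℂ) =ᵐ[arc] fun t => a t * f t :=
  (ContinuousLinearMap.mul ℂ ℂ).coeFn_holder a f

theorem mulOp_mulLInfty (a b : LInfty) : mulOp (mulLInfty a b) = mulOp a ∘L mulOp b := by
  ext1 f
  apply Lp.ext
  filter_upwards [mulOp_ae (mulLInfty a b) f, mulLInfty_ae a b, mulOp_ae a (mulOp b f),
    mulOp_ae b f] with t h1 h2 h3 h4
  rw [ContinuousLinearMap.comp_apply, h1, h2, h3, h4, mul_assoc]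

theorem norm_mulOp_apply_indicator_sq (a : LInfty) {E : Set Torus} (hE : MeasurableSet E) :
    ‖mulOp a (indicatorConstLp 2 hE (measure_ne_top arc E) 1)‖ ^ 2 = ∫ t in E, ‖a t‖ ^ 2 ∂arc := by
  set f := indicatorConstLp 2 hE (measure_ne_top arc E) (1 : ℂ) with hf
  have h : ∀ᵐ t ∂arc, inner ℂ (mulOp a f t) (mulOp a f t) =
      ((E.indicator (fun t => ‖a t‖ ^ 2) t : ℝ) : ℂ) := by
    filter_upwards [mulOp_ae a f, indicatorConstLp_coeFn (p := 2) (hs := hE)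
      (hμs := measure_ne_top arc E) (c := (1 : ℂ))] with t h1 h2
    rw [h1, hf, h2, inner_self_eq_norm_sq_to_K]
    by_cases ht : t ∈ E <;> simp [ht]
  rw [← integral_indicator hE]
  have h2 := inner_self_eq_norm_sq_to_K (𝕜 := ℂ) (mulOp a f)
  rw [L2.inner_def, integral_congr_ae h, integral_complex_ofReal] at h2
  exact (Complex.ofReal_injective (by simpa using h2)).symm

theorem ae_norm_le_norm (a : LInfty) : ∀ᵐ t ∂arc, ‖a t‖ ≤ ‖a‖ := by
  have h := ae_le_eLpNormEssSup (f := (a : Torus → ℂ)) (μ := arc)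
  have hfin : eLpNorm (a : Torus → ℂ) ∞ arc ≠ ∞ := Lp.eLpNorm_ne_top a
  filter_upwards [h] with t ht
  rw [Lp.norm_def]
  rw [← toReal_enorm]
  exact ENNReal.toReal_mono hfin (by simpa [eLpNorm_exponent_top] using ht)

/-- Testing on indicator functions gives `∫_E |a|² ≤ ‖mulOp a‖² |E|` for every measurable `E`, hence
`|a| ≤ ‖mulOp a‖` almost everywhere. -/
theorem norm_le_norm_mulOp (a : LInfty) : ‖a‖ ≤ ‖mulOp a‖ := by
  have hmeas : AEStronglyMeasurable (fun t => ‖a t‖ ^ 2) arc :=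
    (Lp.aestronglyMeasurable a).norm.pow 2
  have hint : Integrable (fun t => ‖a t‖ ^ 2) arc := by
    refine Integrable.of_bound hmeas (‖a‖ ^ 2) ?_
    filter_upwards [ae_norm_le_norm a] with t ht
    rw [norm_pow, norm_norm]
    gcongr
  have hle : (fun t => ‖a t‖ ^ 2) ≤ᵐ[arc] fun _ => ‖mulOp a‖ ^ 2 := by
    refine ae_le_of_forall_setIntegral_le hint (integrable_const _) fun E hE _ => ?_
    rw [← norm_mulOp_apply_indicator_sq a hE, setIntegral_const, smul_eq_mul]
    have h := (mulOp a).le_opNorm (indicatorConstLp 2 hE (measure_ne_top arc E) 1)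
    have h2 : ‖indicatorConstLp 2 hE (measure_ne_top arc E) (1 : ℂ)‖ ^ 2 = arc.real E := by
      rw [norm_indicatorConstLp (by norm_num) (by norm_num), norm_one, one_mul,
        ← Real.rpow_natCast, ← Real.rpow_mul measureReal_nonneg]
      norm_num
    calc _ ≤ (‖mulOp a‖ * ‖indicatorConstLp 2 hE (measure_ne_top arc E) (1 : ℂ)‖) ^ 2 := by gcongr
      _ = _ := by rw [mul_pow, h2, mul_comm]
  have h := Lp.norm_le_of_ae_bound (f := a) (norm_nonneg (mulOp a)) (by
    filter_upwards [hle] with t ht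
    exact (sq_le_sq₀ (norm_nonneg _) (norm_nonneg _)).1 ht)
  simpa using h

theorem laurent_apply (a : LInfty) (x : ell2 ℤ) :
    laurent a x = (fourierBasis (T := 2 * Real.pi)).repr
      (mulOp a ((fourierBasis (T := 2 * Real.pi)).repr.symm x)) := rfl

theorem laurent_add (a b : LInfty) : laurent (a + b) = laurent a + laurent b := by
  ext1 x
  simp only [laurent_apply, mulOp, map_add, add_apply]

theorem laurent_sub (a b : LInfty) : laurent (a - b) = laurent a - laurent b := by
  ext1 x
  simp only [laurent_apply, mulOp, map_sub, sub_apply]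

theorem laurent_mulLInfty (a b : LInfty) : laurent (mulLInfty a b) = laurent a ∘L laurent b := by
  ext1 x
  simp [laurent_apply, mulOp_mulLInfty]

theorem norm_mulOp_le (a : LInfty) : ‖mulOp a‖ ≤ ‖laurent a‖ := by
  refine ContinuousLinearMap.opNorm_le_bound _ (norm_nonneg _) fun f => ?_
  have h := (laurent a).le_opNorm ((fourierBasis (T := 2 * Real.pi)).repr f)
  simpa only [laurent_apply, LinearIsometryEquiv.norm_map, LinearIsometryEquiv.symm_apply_apply]
    using h

theorem norm_laurent (a : LInfty) : ‖laurent a‖ = ‖a‖ := by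
  refine le_antisymm (ContinuousLinearMap.opNorm_le_bound _ (norm_nonneg _) fun x => ?_)
    ((norm_le_norm_mulOp a).trans (norm_mulOp_le a))
  rw [laurent_apply, LinearIsometryEquiv.norm_map]
  refine ((ContinuousLinearMap.mul ℂ ℂ).norm_holder_apply_apply_le a _).trans ?_
  rw [LinearIsometryEquiv.norm_map]
  refine (mul_le_mul_of_nonneg_right (mul_le_mul_of_nonneg_right
    (ContinuousLinearMap.opNorm_mul_le ℂ ℂ) (norm_nonneg _)) (norm_nonneg _)).trans ?_
  rw [one_mul]

theorem laurent_injective : Function.Injective laurent := fun a b h => by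
  rw [← sub_eq_zero, ← norm_eq_zero, ← norm_laurent, laurent_sub, h, sub_self, norm_zero]

theorem adjoint_laurent (a : LInfty) :
    ContinuousLinearMap.adjoint (laurent a) = laurent (star a) := by
  refine ext_entry fun i j => ?_
  rw [entry_adjoint, entry_laurent, entry_laurent, fourierCoeff, fourierCoeff]
  rw [show star (∫ t, fourier (-(j - i)) t • (a : Torus → ℂ) t ∂arc) =
    (starRingEnd ℂ) (∫ t, fourier (-(j - i)) t • (a : Torus → ℂ) t ∂arc) from rfl, ← integral_conj]
  apply integral_congr_ae
  filter_upwards [Lp.coeFn_star a] with t ht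
  rw [ht, smul_eq_mul, map_mul, ← fourier_neg, show -(-(j - i)) = -(i - j) by ring]
  rfl

/-- The constant function with value `c`. -/
def constLInfty (c : ℂ) : LInfty := Lp.const ∞ arc c

theorem laurent_constLInfty (c : ℂ) :
    laurent (constLInfty c) = c • ContinuousLinearMap.id ℂ (ell2 ℤ) := by
  ext1 x
  have h : mulOp (constLInfty c) ((fourierBasis (T := 2 * Real.pi)).repr.symm x) =
      c • (fourierBasis (T := 2 * Real.pi)).repr.symm x := by
    apply Lp.ext
    filter_upwards [mulOp_ae (constLInfty c) ((fourierBasis (T := 2 * Real.pi)).repr.symm x),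
      Lp.coeFn_const (p := ∞) (μ := arc) c,
      Lp.coeFn_smul c ((fourierBasis (T := 2 * Real.pi)).repr.symm x)] with t h1 h2 h3
    rw [h1, h3, constLInfty, h2]
    rfl
  rw [laurent_apply, h, map_smul, LinearIsometryEquiv.apply_symm_apply]
  rfl

theorem shift_basisVec (k n : ℤ) : shift k (basisVec n) = basisVec (n + k) :=
  place_basisVec (add_left_injective k) n

/-- The matrix entries depend only on the difference of the indices. -/
theorem laurent_shift (a : LInfty) (k : ℤ) (x : ell2 ℤ) :
    laurent a (shift k x) = shift k (laurent a x) := by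
  have h : laurent a ∘L shift k = shift k ∘L laurent a := by
    refine ext_entry fun i j => ?_
    have h1 := entry_laurent a i (j + k)
    have h2 := entry_laurent a (i - k) j
    simp only [entry, ContinuousLinearMap.comp_apply, shift_basisVec, shift_apply] at h1 h2 ⊢
    rw [h1, h2]
    congr 1
    ring
  exact DFunLike.congr_fun h x

theorem fourierCoeff_reflect (a : LInfty) (n : ℤ) :
    fourierCoeff (reflect a : Torus → ℂ) n = fourierCoeff (a : Torus → ℂ) (-n) := by
  unfold fourierCoeff
  rw [← integral_neg_eq_self (μ := arc) fun t => fourier (- -n) t • (a : Torus → ℂ) t]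
  apply integral_congr_ae
  filter_upwards [reflect_ae a] with t ht
  rw [ht]
  simp [fourier_apply]

/-- The flip `(J x)_n = x_{-1-n}` on `l²(ℤ)`. -/
def flip : ell2 ℤ →L[ℂ] ell2 ℤ :=
  (place (fun n : ℤ => -1 - n) (sub_right_injective (b := -1))).toContinuousLinearMap

theorem flip_basisVec (n : ℤ) : flip (basisVec n) = basisVec (-1 - n) :=
  place_basisVec sub_right_injective n

theorem flip_apply (x : ell2 ℤ) (n : ℤ) : flip x n = x (-1 - n) := by
  have h := place_apply (f := fun n : ℤ => -1 - n) sub_right_injective x (-1 - n)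
  simpa [flip] using h

theorem adjoint_flip : ContinuousLinearMap.adjoint flip = flip := by
  refine ext_entry fun i j => ?_
  rw [entry_adjoint]
  simp only [entry, flip_basisVec, basisVec_apply]
  by_cases h : j = -1 - i
  · rw [if_pos h, if_pos (by omega), star_one]
  · rw [if_neg h, if_neg (by omega), star_zero]

/-- Flipping both indices turns `i - j` into `j - i`, and so negates the index of the Fourier
coefficient. -/
theorem flip_laurent_flip (a : LInfty) : flip ∘L laurent a ∘L flip = laurent (reflect a) := by
  refine ext_entry fun i j => ?_
  have h := entry_laurent a (-1 - i) (-1 - j)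
  rw [entry_laurent, fourierCoeff_reflect]
  simp only [entry, ContinuousLinearMap.comp_apply, flip_basisVec, flip_apply] at h ⊢
  rw [h]
  congr 1
  ring

/-! ### Limits along the shifts -/

/-- The operator `U_{-n} A U_n`, where `A` is extended by zero to `l²(ℤ)`. -/
def translate (n : ℕ) (A : ell2 ℕ →L[ℂ] ell2 ℕ) : ell2 ℤ →L[ℂ] ell2 ℤ :=
  shift (-(n : ℤ)) ∘L (incl ∘L A ∘L proj) ∘L shift (n : ℤ)

theorem norm_shift_apply (k : ℤ) (x : ell2 ℤ) : ‖shift k x‖ = ‖x‖ :=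
  (place (fun n : ℤ => n + k) (add_left_injective k)).norm_map x

theorem norm_incl_apply (x : ell2 ℕ) : ‖incl x‖ = ‖x‖ :=
  (place (fun n : ℕ => (n : ℤ)) Nat.cast_injective).norm_map x

theorem norm_proj_apply_le (x : ell2 ℤ) : ‖proj x‖ ≤ ‖x‖ := by
  have h : ‖proj‖ ≤ 1 := by
    rw [proj, LinearIsometryEquiv.norm_map]
    exact LinearIsometry.norm_toContinuousLinearMap_le _
  simpa using ContinuousLinearMap.le_of_opNorm_le _ h x

theorem incl_apply (x : ell2 ℕ) (n : ℕ) : incl x (n : ℤ) = x n :=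
  place_apply (f := fun n : ℕ => (n : ℤ)) Nat.cast_injective x n

theorem incl_apply_of_neg (x : ell2 ℕ) {n : ℤ} (h : n < 0) : incl x n = 0 :=
  Function.extend_apply' _ _ _ (by rintro ⟨m, hm⟩; omega)

theorem proj_incl (x : ell2 ℕ) : proj (incl x) = x := by
  ext n
  rw [proj_apply, incl_apply]

theorem shift_shift_neg (k : ℤ) (x : ell2 ℤ) : shift k (shift (-k) x) = x := by
  ext n
  simp [shift_apply]

theorem adjoint_shift (k : ℤ) : ContinuousLinearMap.adjoint (shift k) = shift (-k) := by
  refine ext_entry fun i j => ?_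
  rw [entry_adjoint]
  simp only [entry, shift_basisVec, basisVec_apply]
  by_cases h : j = i + k
  · rw [if_pos h, if_pos (by omega), star_one]
  · rw [if_neg h, if_neg (by omega), star_zero]

theorem translate_apply (n : ℕ) (A : ell2 ℕ →L[ℂ] ell2 ℕ) (x : ell2 ℤ) :
    translate n A x = shift (-(n : ℤ)) (incl (A (proj (shift (n : ℤ) x)))) := rfl

theorem adjoint_translate (n : ℕ) (A : ell2 ℕ →L[ℂ] ell2 ℕ) :
    ContinuousLinearMap.adjoint (translate n A) = translate n (ContinuousLinearMap.adjoint A) := by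
  simp only [translate, ContinuousLinearMap.adjoint_comp, adjoint_shift, neg_neg, proj,
    ContinuousLinearMap.adjoint_adjoint, ContinuousLinearMap.comp_assoc]

theorem norm_translate_apply_le (n : ℕ) (A : ell2 ℕ →L[ℂ] ell2 ℕ) (x : ell2 ℤ) :
    ‖translate n A x‖ ≤ ‖A‖ * ‖x‖ := by
  rw [translate_apply, norm_shift_apply, norm_incl_apply]
  refine (A.le_opNorm _).trans ?_
  gcongr
  exact (norm_proj_apply_le _).trans_eq (norm_shift_apply _ _)

/-- Exactly multiplicative, since the inner factors `U_n U_{-n}` and `proj ∘ incl` are identities.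
Still, `translate n 1` is only the projection onto the coordinates `≥ -n`. -/
theorem translate_mul (n : ℕ) (A B : ell2 ℕ →L[ℂ] ell2 ℕ) (x : ell2 ℤ) :
    translate n (A * B) x = translate n A (translate n B x) := by
  simp only [translate_apply, shift_shift_neg, proj_incl]
  rfl

theorem translate_add (n : ℕ) (A B : ell2 ℕ →L[ℂ] ell2 ℕ) (x : ell2 ℤ) :
    translate n (A + B) x = translate n A x + translate n B x := by
  simp only [translate_apply, add_apply, map_add]

theorem translate_sub (n : ℕ) (A B : ell2 ℕ →L[ℂ] ell2 ℕ) (x : ell2 ℤ) :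
    translate n (A - B) x = translate n A x - translate n B x := by
  simp only [translate_apply, sub_apply, map_sub]

/-- `B` is the strong limit of the operators `U_{-n} A U_n`. -/
def TranslatesTo (A : ell2 ℕ →L[ℂ] ell2 ℕ) (B : ell2 ℤ →L[ℂ] ell2 ℤ) : Prop :=
  ∀ x, Tendsto (fun n => translate n A x) atTop (𝓝 (B x))

theorem isSymbol_iff {A : ell2 ℕ →L[ℂ] ell2 ℕ} {s : LInfty} :
    IsSymbol A s ↔ TranslatesTo A (laurent s) ∧
      TranslatesTo (ContinuousLinearMap.adjoint A) (ContinuousLinearMap.adjoint (laurent s)) := by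
  refine and_congr Iff.rfl (forall_congr' fun x => ?_)
  simp only [← adjoint_translate]
  rfl

namespace TranslatesTo

variable {A A' : ell2 ℕ →L[ℂ] ell2 ℕ} {B B' : ell2 ℤ →L[ℂ] ell2 ℤ}

theorem add (h : TranslatesTo A B) (h' : TranslatesTo A' B') : TranslatesTo (A + A') (B + B') :=
  fun x => ((h x).add (h' x)).congr fun n => (translate_add n A A' x).symm

theorem sub (h : TranslatesTo A B) (h' : TranslatesTo A' B') : TranslatesTo (A - A') (B - B') :=
  fun x => ((h x).sub (h' x)).congr fun n => (translate_sub n A A' x).symm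

theorem mul (h : TranslatesTo A B) (h' : TranslatesTo A' B') :
    TranslatesTo (A * A') (B ∘L B') := fun x => by
  have h1 : Tendsto (fun n => ‖A‖ * ‖translate n A' x - B' x‖) atTop (𝓝 0) := by
    simpa using ((h' x).sub_const (B' x)).norm.const_mul ‖A‖
  have h2 : Tendsto (fun n => translate n A (translate n A' x - B' x)) atTop (𝓝 0) :=
    squeeze_zero_norm (fun n => norm_translate_apply_le n A _) h1
  refine (by simpa using h2.add (h (B' x)) : Tendsto _ atTop (𝓝 (B (B' x)))).congr fun n => ?_
  simp [translate_mul]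

theorem norm_le (h : TranslatesTo A B) : ‖B‖ ≤ ‖A‖ :=
  B.opNorm_le_bound (norm_nonneg _) fun x =>
    le_of_tendsto (h x).norm (Eventually.of_forall fun n => norm_translate_apply_le n A x)

theorem unique (h : TranslatesTo A B) (h' : TranslatesTo A B') : B = B' := by
  ext1 x
  exact tendsto_nhds_unique (h x) (h' x)

theorem of_tendsto {F : ℕ → ell2 ℕ →L[ℂ] ell2 ℕ} {G : ℕ → ell2 ℤ →L[ℂ] ell2 ℤ}
    (h : ∀ k, TranslatesTo (F k) (G k)) (hF : Tendsto F atTop (𝓝 A)) (hG : Tendsto G atTop (𝓝 B)) :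
    TranslatesTo A B := fun x => by
  -- The convergence in `k` is uniform in `n`, as `‖translate n A x‖ ≤ ‖A‖ ‖x‖`; this permits
  -- exchanging the two limits.
  have h1 : TendstoUniformly (fun k n => translate n (F k) x) (fun n => translate n A x) atTop := by
    rw [Metric.tendstoUniformly_iff]
    intro ε hε
    have h2 : Tendsto (fun k => ‖A - F k‖ * ‖x‖) atTop (𝓝 0) := by
      simpa using ((hF.const_sub A).norm).mul_const ‖x‖
    filter_upwards [h2.eventually_lt_const hε] with k hk n
    rw [dist_eq_norm, ← translate_sub]
    exact (norm_translate_apply_le n _ x).trans_lt hk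
  exact h1.tendsto_of_eventually_tendsto (Eventually.of_forall fun k => h k x)
    (((ContinuousLinearMap.apply ℂ (ell2 ℤ) x).continuous.tendsto B).comp hG)

end TranslatesTo

/-! ### Symbols -/

/-- On a basis vector the sequence is eventually constant; the span of these is dense and the
operators are uniformly bounded. -/
theorem tendsto_translate_one (x : ell2 ℤ) :
    Tendsto (fun n : ℕ => translate n 1 x) atTop (𝓝 x) := by
  have h : ∀ y : ell2 ℤ, y ∈ (Submodule.span ℂ (Set.range (basisVec (I := ℤ)))) →
      Tendsto (fun n : ℕ => translate n 1 y) atTop (𝓝 y) := by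
    intro y hy
    induction hy using Submodule.span_induction with
    | mem y hy =>
      obtain ⟨j, rfl⟩ := hy
      refine tendsto_const_nhds.congr' ?_
      filter_upwards [eventually_ge_atTop j.natAbs] with n hn
      have h1 : j + n = ((j + n).toNat : ℤ) := by omega
      rw [translate_apply, shift_basisVec, h1, ← incl_basisVec, proj_incl,
        one_apply_eq_self, incl_basisVec, ← h1, shift_basisVec, add_neg_cancel_right]
    | zero => simp
    | add y z _ _ hy hz => simpa using hy.add hz
    | smul c y _ hy => simpa using hy.const_smul c
  have hx : x ∈ closure (Submodule.span ℂ (Set.range (basisVec (I := ℤ))) : Set (ell2 ℤ)) := by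
    refine mem_closure_of_tendsto (hasSum_smul_basisVec x) (Eventually.of_forall fun s => ?_)
    exact Submodule.sum_mem _ fun i _ =>
      Submodule.smul_mem _ _ (Submodule.subset_span (Set.mem_range_self i))
  obtain ⟨y, hy, hyx⟩ := mem_closure_iff_seq_limit.1 hx
  have h1 : TendstoUniformly (fun k n => translate n 1 (y k)) (fun n => translate n 1 x)
      atTop := by
    rw [Metric.tendstoUniformly_iff]
    intro ε hε
    have h2 : Tendsto (fun k => ‖(1 : ell2 ℕ →L[ℂ] ell2 ℕ)‖ * ‖x - y k‖) atTop (𝓝 0) := by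
      simpa using (hyx.const_sub x).norm.const_mul ‖(1 : ell2 ℕ →L[ℂ] ell2 ℕ)‖
    filter_upwards [h2.eventually_lt_const hε] with k hk n
    rw [dist_eq_norm, ← map_sub]
    exact (norm_translate_apply_le n _ _).trans_lt hk
  exact h1.tendsto_of_eventually_tendsto (Eventually.of_forall fun k => h _ (hy k)) hyx

/-- With `Q_n = translate n 1`, shift invariance of `L(a)` gives `U_{-n} T(a) U_n = Q_n L(a) Q_n`,
and `Q_n → I` strongly. -/
theorem translatesTo_toeplitz (a : LInfty) : TranslatesTo (toeplitz a) (laurent a) := fun x => by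
  have h : ∀ n : ℕ, translate n (toeplitz a) x =
      translate n 1 (laurent a (translate n 1 x - x)) + translate n 1 (laurent a x) := by
    intro n
    rw [← map_add, ← map_add, sub_add_cancel]
    simp only [translate_apply, laurent_shift, shift_shift_neg]
    rfl
  simp only [h]
  have h1 : Tendsto (fun n => laurent a (translate n 1 x - x)) atTop (𝓝 0) := by
    have h2 := ((laurent a).continuous.tendsto _).comp
      ((tendsto_translate_one x).sub_const x)
    simpa [Function.comp_def] using h2
  have h3 : Tendsto (fun n => translate n 1 (laurent a (translate n 1 x - x))) atTop (𝓝 0) := by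
    refine squeeze_zero_norm (fun n => norm_translate_apply_le n _ _) ?_
    simpa using h1.norm.const_mul ‖(1 : ell2 ℕ →L[ℂ] ell2 ℕ)‖
  simpa using h3.add (tendsto_translate_one (laurent a x))

theorem adjoint_toeplitz (a : LInfty) :
    ContinuousLinearMap.adjoint (toeplitz a) = toeplitz (star a) := by
  simp only [toeplitz, proj, ContinuousLinearMap.adjoint_comp, adjoint_laurent,
    ContinuousLinearMap.adjoint_adjoint, ContinuousLinearMap.comp_assoc]

theorem isSymbol_toeplitz (a : LInfty) : IsSymbol (toeplitz a) a := by
  rw [isSymbol_iff, adjoint_toeplitz, adjoint_laurent]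
  exact ⟨translatesTo_toeplitz a, translatesTo_toeplitz (star a)⟩

theorem IsSymbol.unique {A : ell2 ℕ →L[ℂ] ell2 ℕ} {s t : LInfty} (hs : IsSymbol A s)
    (ht : IsSymbol A t) : s = t :=
  laurent_injective ((isSymbol_iff.1 hs).1.unique (isSymbol_iff.1 ht).1)

theorem IsSymbol.add {A B : ell2 ℕ →L[ℂ] ell2 ℕ} {s t : LInfty} (hs : IsSymbol A s)
    (ht : IsSymbol B t) : IsSymbol (A + B) (s + t) := by
  rw [isSymbol_iff] at *
  rw [laurent_add, map_add, map_add]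
  exact ⟨hs.1.add ht.1, hs.2.add ht.2⟩

theorem IsSymbol.mul {A B : ell2 ℕ →L[ℂ] ell2 ℕ} {s t : LInfty} (hs : IsSymbol A s)
    (ht : IsSymbol B t) : IsSymbol (A * B) (mulLInfty s t) := by
  rw [isSymbol_iff] at *
  rw [laurent_mulLInfty, ContinuousLinearMap.adjoint_comp, ContinuousLinearMap.mul_def,
    ContinuousLinearMap.adjoint_comp]
  exact ⟨hs.1.mul ht.1, ht.2.mul hs.2⟩

theorem IsSymbol.adjoint {A : ell2 ℕ →L[ℂ] ell2 ℕ} {s : LInfty} (hs : IsSymbol A s) :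
    IsSymbol (ContinuousLinearMap.adjoint A) (star s) := by
  rw [isSymbol_iff] at *
  rw [← adjoint_laurent, ContinuousLinearMap.adjoint_adjoint, ContinuousLinearMap.adjoint_adjoint]
  exact hs.symm

theorem isSymbol_algebraMap (c : ℂ) :
    IsSymbol (algebraMap ℂ (ell2 ℕ →L[ℂ] ell2 ℕ) c) (constLInfty c) := by
  -- Needed for all constants, because the adjoint half uses it at `star c`.
  have h : ∀ c : ℂ, TranslatesTo (algebraMap ℂ _ c) (laurent (constLInfty c)) := fun c x => by
    rw [laurent_constLInfty]
    refine ((tendsto_translate_one x).const_smul c).congr fun n => ?_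
    simp [translate_apply, Algebra.algebraMap_eq_smul_one]
  rw [isSymbol_iff]
  refine ⟨h c, ?_⟩
  have h1 : ContinuousLinearMap.adjoint (laurent (constLInfty c)) =
      laurent (constLInfty (star c)) := by
    rw [laurent_constLInfty, laurent_constLInfty, map_smulₛₗ]
    congr 1
    exact star_one (ell2 ℤ →L[ℂ] ell2 ℤ)
  rw [h1, ← ContinuousLinearMap.star_eq_adjoint, ← algebraMap_star_comm]
  exact h _

/-- Makes the symbol map a contraction, so it extends from the generated algebra to its closure. -/
theorem IsSymbol.norm_sub_le {A B : ell2 ℕ →L[ℂ] ell2 ℕ} {s t : LInfty} (hs : IsSymbol A s)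
    (ht : IsSymbol B t) : ‖s - t‖ ≤ ‖A - B‖ := by
  rw [← norm_laurent, laurent_sub]
  exact ((isSymbol_iff.1 hs).1.sub (isSymbol_iff.1 ht).1).norm_le

theorem continuous_laurent : Continuous laurent := by
  refine (LipschitzWith.of_dist_le_mul (K := 1) fun a b => ?_).continuous
  rw [dist_eq_norm, dist_eq_norm, ← laurent_sub, norm_laurent, NNReal.coe_one, one_mul]

theorem exists_isSymbol {A : ell2 ℕ →L[ℂ] ell2 ℕ} (hA : A ∈ toeplitzAlgebra) :
    ∃ s, IsSymbol A s := by
  have hadj : ∀ A ∈ StarAlgebra.adjoin ℂ (Set.range toeplitz), ∃ s, IsSymbol A s := by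
    intro A hA
    induction hA using StarAlgebra.adjoin_induction with
    | mem A hA =>
      obtain ⟨a, rfl⟩ := hA
      exact ⟨a, isSymbol_toeplitz a⟩
    | algebraMap c => exact ⟨_, isSymbol_algebraMap c⟩
    | add A B _ _ hA hB =>
      obtain ⟨s, hs⟩ := hA
      obtain ⟨t, ht⟩ := hB
      exact ⟨_, hs.add ht⟩
    | mul A B _ _ hA hB =>
      obtain ⟨s, hs⟩ := hA
      obtain ⟨t, ht⟩ := hB
      exact ⟨_, hs.mul ht⟩
    | star A _ hA =>
      obtain ⟨s, hs⟩ := hA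
      exact ⟨_, hs.adjoint⟩
  obtain ⟨F, hF, hFA⟩ := mem_closure_iff_seq_limit.1
    (show A ∈ closure (StarAlgebra.adjoin ℂ (Set.range toeplitz) : Set _) from hA)
  choose s hs using fun k => hadj (F k) (hF k)
  have hcauchy : CauchySeq s := by
    have h := hFA.cauchySeq
    rw [Metric.cauchySeq_iff] at h ⊢
    intro ε hε
    obtain ⟨N, hN⟩ := h ε hε
    refine ⟨N, fun m hm n hn => ?_⟩
    have h1 := hN m hm n hn
    rw [dist_eq_norm] at h1 ⊢
    exact ((hs m).norm_sub_le (hs n)).trans_lt h1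
  obtain ⟨t, ht⟩ := cauchySeq_tendsto_of_complete hcauchy
  have hlt := (continuous_laurent.tendsto t).comp ht
  refine ⟨t, isSymbol_iff.2 ⟨TranslatesTo.of_tendsto (fun k => (isSymbol_iff.1 (hs k)).1) hFA hlt,
    TranslatesTo.of_tendsto (fun k => (isSymbol_iff.1 (hs k)).2) ?_ ?_⟩⟩
  · exact (ContinuousLinearMap.adjoint.continuous.tendsto A).comp hFA
  · exact (ContinuousLinearMap.adjoint.continuous.tendsto (laurent t)).comp hlt

/-! ### Finite sections and determinants -/

/-- Let `T(b) x = e_0`. If `x_0 = 0`, then `x` is the forward shift of some `y`, and `T(b) y` is the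
backward shift of `T(b) x = e_0`, which is zero. Injectivity gives `y = 0`, hence `x = 0`, a
contradiction. -/
theorem invEntry_toeplitz_ne_zero {b : LInfty} (hu : IsUnit (toeplitz b)) :
    invEntry (toeplitz b) ≠ 0 := by
  intro h0
  set x : ell2 ℕ := Ring.inverse (toeplitz b) (basisVec 0) with hx
  have hTx : toeplitz b x = basisVec 0 := by
    change (toeplitz b * Ring.inverse (toeplitz b)) (basisVec 0) = basisVec 0
    rw [Ring.mul_inverse_cancel _ hu]
    rfl
  have hx0 : x 0 = 0 := h0
  set y : ell2 ℕ := proj (shift (-1) (incl x)) with hy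
  have hxy : incl x = shift 1 (incl y) := by
    ext n
    rw [shift_apply]
    rcases lt_or_ge (n - 1) 0 with hn | hn
    · rw [incl_apply_of_neg y hn]
      rcases lt_or_ge n 0 with hn' | hn'
      · exact incl_apply_of_neg x hn'
      · obtain rfl : n = ((0 : ℕ) : ℤ) := by omega
        rw [incl_apply, hx0]
    · obtain ⟨m, hm⟩ := Int.eq_ofNat_of_zero_le hn
      rw [hm, incl_apply, hy, proj_apply, shift_apply, ← hm, show n - 1 - -1 = n by ring]
  have hTy : toeplitz b y = 0 := by
    ext n
    have h1 : toeplitz b x (n + 1) = toeplitz b y n := by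
      simp only [toeplitz, ContinuousLinearMap.comp_apply, proj_apply, hxy, laurent_shift,
        shift_apply]
      simp
    rw [← h1, hTx, basisVec_apply, if_neg (by omega)]
    rfl
  have hinj := (ContinuousLinearMap.isUnit_iff_bijective.1 hu).1
  have hy0 : y = 0 := hinj (hTy.trans (map_zero _).symm)
  have hx' : x = 0 := by
    rw [← norm_eq_zero, ← norm_incl_apply, hxy, norm_shift_apply, norm_incl_apply, hy0, norm_zero]
  have h1 : (basisVec 0 : ell2 ℕ) 0 = 0 := by
    rw [← hTx, hx', map_zero]
    rfl
  rw [basisVec_apply, if_pos rfl] at h1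
  exact one_ne_zero h1

/-- If a stable sequence of matrices, each obtained from the next one by deleting the first row and
the first column, converges `*`-strongly to a Toeplitz operator, then the quotients of consecutive
determinants converge. -/
theorem tendsto_det_div_det {M : ∀ n, Matrix (Fin n) (Fin n) ℂ} {b : LInfty}
    (hM : ∀ n, (M (n + 1)).submatrix Fin.succ Fin.succ = M n)
    (hB : ∀ x, Tendsto (fun n => matOp (M n) x) atTop (𝓝 (toeplitz b x)))
    (hB' : ∀ x, Tendsto (fun n => ContinuousLinearMap.adjoint (matOp (M n)) x) atTop
      (𝓝 (ContinuousLinearMap.adjoint (toeplitz b) x))) {C : ℝ}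
    (hC : ∀ᶠ n in atTop, IsUnit (M n) ∧ ‖matOp (M n)⁻¹‖ ≤ C) :
    IsUnit (toeplitz b) ∧ invEntry (toeplitz b) ≠ 0 ∧
      Tendsto (fun n : ℕ => (M (n + 1)).det / (M n).det) atTop
        (𝓝 (1 / invEntry (toeplitz b))) := by
  have hu := isUnit_of_tendsto_matOp hB hB' hC
  have h0 := invEntry_toeplitz_ne_zero hu
  refine ⟨hu, h0, ?_⟩
  rw [one_div]
  refine ((tendsto_inv_zero_zero hB hC hu).inv₀ h0).congr fun n => ?_
  -- Cramer's rule: the 00 cofactor is the determinant of `M n`, by `hM`.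
  rw [Matrix.inv_def, Matrix.smul_apply, Matrix.adjugate_fin_succ_eq_det_submatrix]
  simp [Fin.succAbove_zero, hM, mul_comm, div_eq_mul_inv]

theorem matOp_finSec (A : ell2 ℕ →L[ℂ] ell2 ℕ) (n : ℕ) :
    matOp (finSec A n) = (emb n).toContinuousLinearMap ∘L cut n ∘L A ∘L
      (emb n).toContinuousLinearMap ∘L cut n := by
  refine ext_entry fun i j => ?_
  rcases lt_or_ge i n with hi | hi
  · rcases lt_or_ge j n with hj | hj
    · lift i to Fin n using hi
      lift j to Fin n using hj
      rw [entry_matOp_fin]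
      simp only [entry, ContinuousLinearMap.comp_apply, LinearIsometry.coe_toContinuousLinearMap,
        ← emb_single j, cut_emb, emb_apply_fin, cut_apply]
      rw [emb_single]
      rfl
    · rw [entry_matOp_of_le_right _ _ hj]
      simp [entry, cut_basisVec_of_le hj]
  · rw [entry_matOp_of_le_left _ _ hi]
    exact (emb_apply_of_le _ hi).symm

theorem tendsto_matOp_finSec (A : ell2 ℕ →L[ℂ] ell2 ℕ) (x : ell2 ℕ) :
    Tendsto (fun n => matOp (finSec A n) x) atTop (𝓝 (A x)) := by
  have h1 : Tendsto (fun n => A (emb n (cut n x) - x)) atTop (𝓝 0) := by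
    have h := (A.continuous.tendsto _).comp ((tendsto_emb_cut x).sub_const x)
    simpa [Function.comp_def] using h
  have h2 : Tendsto (fun n => emb n (cut n (A (emb n (cut n x) - x)))) atTop (𝓝 0) := by
    refine squeeze_zero_norm (fun n => ?_) (by simpa only [norm_zero] using h1.norm)
    rw [LinearIsometry.norm_map]
    exact norm_cut_apply_le _ _
  refine (by simpa using h2.add (tendsto_emb_cut (A x)) : Tendsto _ atTop (𝓝 (A x))).congr
    fun n => ?_
  rw [matOp_finSec]
  simp

theorem conjTranspose_finSec (A : ell2 ℕ →L[ℂ] ell2 ℕ) (n : ℕ) :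
    (finSec A n).conjTranspose = finSec (ContinuousLinearMap.adjoint A) n := by
  ext i j
  simp [finSec, entry_adjoint]

/-- The finite section of `A` with the order of its rows and columns reversed. -/
def revSec (A : ell2 ℕ →L[ℂ] ell2 ℕ) (n : ℕ) : Matrix (Fin n) (Fin n) ℂ :=
  (finSec A n).submatrix Fin.revPerm Fin.revPerm

/-- The purpose of the reversal: the row and column that distinguish consecutive sections now come
first. -/
theorem revSec_submatrix_succ (A : ell2 ℕ →L[ℂ] ell2 ℕ) (n : ℕ) :
    (revSec A (n + 1)).submatrix Fin.succ Fin.succ = revSec A n := by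
  ext i j
  simp [revSec, finSec, Fin.val_rev]

/-- The index `i` goes to `-1 - i` under the flip and to `n - 1 - i` after the shift. For `i < n`
this is the reversed index; for `i ≥ n` it is negative and hence cut off. -/
theorem matOp_revSec (A : ell2 ℕ →L[ℂ] ell2 ℕ) (n : ℕ) :
    matOp (revSec A n) = proj ∘L flip ∘L translate n A ∘L flip ∘L incl := by
  refine ext_entry fun i j => ?_
  simp only [entry, ContinuousLinearMap.comp_apply, incl_basisVec, flip_basisVec, proj_apply,
    flip_apply, translate_apply, shift_basisVec, shift_apply]
  rcases lt_or_ge j n with hj | hj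
  · rw [show -1 - (j : ℤ) + n = ((n - (j + 1) : ℕ) : ℤ) by omega, ← incl_basisVec, proj_incl]
    rcases lt_or_ge i n with hi | hi
    · rw [show -1 - (i : ℤ) - -(n : ℤ) = ((n - (i + 1) : ℕ) : ℤ) by omega, incl_apply]
      lift i to Fin n using hi
      lift j to Fin n using hj
      refine (entry_matOp_fin _ i j).trans ?_
      simp [revSec, finSec, entry, Fin.val_rev]
    · rw [incl_apply_of_neg _ (by omega)]
      exact entry_matOp_of_le_left _ _ hi
  · have h0 : proj (basisVec (-1 - (j : ℤ) + n)) = 0 := by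
      ext k
      rw [proj_apply, basisVec_apply, if_neg (by omega)]
      rfl
    rw [h0, map_zero, map_zero]
    exact entry_matOp_of_le_right _ _ hj

theorem toeplitz_reflect (s : LInfty) :
    toeplitz (reflect s) = proj ∘L flip ∘L laurent s ∘L flip ∘L incl := by
  rw [toeplitz, ← flip_laurent_flip]
  rfl

theorem tendsto_matOp_revSec {A : ell2 ℕ →L[ℂ] ell2 ℕ} {s : LInfty} (hs : IsSymbol A s)
    (x : ell2 ℕ) : Tendsto (fun n => matOp (revSec A n) x) atTop (𝓝 (toeplitz (reflect s) x)) := by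
  simp only [matOp_revSec, toeplitz_reflect]
  exact ((proj ∘L flip).continuous.tendsto _).comp (hs.1 (flip (incl x)))

theorem tendsto_adjoint_matOp_revSec {A : ell2 ℕ →L[ℂ] ell2 ℕ} {s : LInfty} (hs : IsSymbol A s)
    (x : ell2 ℕ) : Tendsto (fun n => ContinuousLinearMap.adjoint (matOp (revSec A n)) x) atTop
      (𝓝 (ContinuousLinearMap.adjoint (toeplitz (reflect s)) x)) := by
  simp only [matOp_revSec, toeplitz_reflect, ContinuousLinearMap.adjoint_comp, adjoint_flip, proj,
    ContinuousLinearMap.adjoint_adjoint]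
  exact ((ContinuousLinearMap.adjoint incl ∘L flip).continuous.tendsto _).comp
    (hs.2 (flip (incl x)))

/-- Simultaneous permutation of rows and columns is conjugation by a unitary. -/
theorem norm_toEuclideanCLM_submatrix_le {n : Type*} [Fintype n] [DecidableEq n]
    (M : Matrix n n ℂ) (e : n ≃ n) :
    ‖Matrix.toEuclideanCLM (𝕜 := ℂ) (M.submatrix e e)‖ ≤ ‖Matrix.toEuclideanCLM (𝕜 := ℂ) M‖ := by
  refine ContinuousLinearMap.opNorm_le_bound _ (norm_nonneg _) fun x => ?_
  have h : Matrix.toEuclideanCLM (𝕜 := ℂ) (M.submatrix e e) x =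
      LinearIsometryEquiv.piLpCongrLeft 2 ℂ ℂ e.symm (Matrix.toEuclideanCLM (𝕜 := ℂ) M
        (LinearIsometryEquiv.piLpCongrLeft 2 ℂ ℂ e x)) := by
    ext i
    simp only [Matrix.ofLp_toEuclideanCLM, Matrix.submatrix_mulVec_equiv]
    rfl
  rw [h, LinearIsometryEquiv.norm_map]
  exact (ContinuousLinearMap.le_opNorm _ _).trans_eq (by rw [LinearIsometryEquiv.norm_map])

theorem StableSections.exists_bound {A : ell2 ℕ →L[ℂ] ell2 ℕ} (h : StableSections A) :
    ∃ C : ℝ, ∀ᶠ n in atTop, IsUnit (finSec A n) ∧ ‖matOp (finSec A n)⁻¹‖ ≤ C := by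
  obtain ⟨N, C, h⟩ := h
  refine ⟨C, ?_⟩
  filter_upwards [eventually_ge_atTop N] with n hn
  exact ⟨(h n hn).1, norm_matOp_inv_le (h n hn).2⟩

theorem StableSections.exists_bound_revSec {A : ell2 ℕ →L[ℂ] ell2 ℕ} (h : StableSections A) :
    ∃ C : ℝ, ∀ᶠ n in atTop, IsUnit (revSec A n) ∧ ‖matOp (revSec A n)⁻¹‖ ≤ C := by
  obtain ⟨N, C, h⟩ := h
  refine ⟨C, ?_⟩
  filter_upwards [eventually_ge_atTop N] with n hn
  refine ⟨(Matrix.isUnit_submatrix_equiv _ _).2 (h n hn).1, norm_matOp_inv_le ?_⟩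
  rw [revSec, Matrix.inv_submatrix_equiv]
  exact (norm_toEuclideanCLM_submatrix_le _ _).trans (h n hn).2

theorem det_revSec (A : ell2 ℕ →L[ℂ] ell2 ℕ) (n : ℕ) : (revSec A n).det = (finSec A n).det :=
  Matrix.det_submatrix_equiv_self _ _

/-- A matrix constant along diagonals loses its first or its last row and column with the same
result. Hence no reversal is needed, and the limit involves `a` itself instead of its reflection. -/
theorem finSec_toeplitz_submatrix_succ (a : LInfty) (n : ℕ) :
    (finSec (toeplitz a) (n + 1)).submatrix Fin.succ Fin.succ = finSec (toeplitz a) n := by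
  ext i j
  simp [finSec, entry_toeplitz]

theorem toeplitz_mem_toeplitzAlgebra (a : LInfty) : toeplitz a ∈ toeplitzAlgebra :=
  StarSubalgebra.le_topologicalClosure _ (StarAlgebra.subset_adjoin ℂ _ (Set.mem_range_self a))

end SzegoToeplitz

end

open SzegoToeplitz in
theorem corollary3p5 :
    -- every operator in the Toeplitz algebra has one and only one symbol
    (∀ A ∈ toeplitzAlgebra, ∃! s : LInfty, IsSymbol A s) ∧
    -- the limit of the quotients of consecutive determinants
    (∀ A ∈ toeplitzAlgebra, StableSections A → ∀ s : LInfty, IsSymbol A s →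
      IsUnit (toeplitz (reflect s)) ∧ invEntry (toeplitz (reflect s)) ≠ 0 ∧
      Tendsto (fun n : ℕ => (finSec A (n + 1)).det / (finSec A n).det) atTop
        (𝓝 (1 / invEntry (toeplitz (reflect s))))) ∧
    -- the case of a Toeplitz operator
    (∀ a : LInfty, toeplitz a ∈ toeplitzAlgebra ∧ IsSymbol (toeplitz a) a ∧
      (StableSections (toeplitz a) →
        IsUnit (toeplitz a) ∧ invEntry (toeplitz a) ≠ 0 ∧
        Tendsto (fun n : ℕ => (finSec (toeplitz a) (n + 1)).det / (finSec (toeplitz a) n).det) atTop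
          (𝓝 (1 / invEntry (toeplitz a))))) := by
  refine ⟨fun A hA => ?_, fun A _ hst s hs => ?_, fun a =>
    ⟨toeplitz_mem_toeplitzAlgebra a, isSymbol_toeplitz a, fun hst => ?_⟩⟩
  · obtain ⟨s, hs⟩ := exists_isSymbol hA
    exact ⟨s, hs, fun t ht => ht.unique hs⟩
  · obtain ⟨C, hC⟩ := hst.exists_bound_revSec
    simpa only [det_revSec] using tendsto_det_div_det (revSec_submatrix_succ A)
      (tendsto_matOp_revSec hs) (tendsto_adjoint_matOp_revSec hs) hC
  · obtain ⟨C, hC⟩ := hst.exists_bound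
    refine tendsto_det_div_det (finSec_toeplitz_submatrix_succ a) (tendsto_matOp_finSec _)
      (fun x => ?_) hC
    -- The adjoints are the finite sections of the adjoint operator, so strong convergence applies
    -- again.
    simp only [adjoint_matOp, conjTranspose_finSec]
    exact tendsto_matOp_finSec _ x
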